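/- Let $n\ge 2$. For a measurable function $u$ on $\mathbb{R}^n$ let $$\mathcal{S}u(x)=\sup_{t>0}\frac{1}{\mathcal{H}^{n-1}(S^{n-1}(x,t))}\int_{S^{n-1}(x,t)}|u|\,d\mathcal{H}^{n-1}\in[0,\infty]$$ be its spherical maximal function, where $S^{n-1}(x,t)=\{z\in\mathbb{R}^n:|z-x|=t\}$ and $\mathcal{H}^{n-1}$ is the $(n-1)$-dimensional Hausdorff measure. Then there is a compactly supported $u\in W^{1,1}(\mathbb{R}^n)$, which can be taken nonnegative, such that $\mathcal{S}u\notin W^{1,1}_{\rm loc}(\mathbb{R}^n)$. More precisely, call $u:\mathbb{R}^n\to\mathbb{R}$ admissible if it has compact support, is $C^\infty$ on $\mathbb{R}^n\setminus\{0\}$, and $$u(x)=|x|^{1-n}\Big(\log\frac{e}{|x|}\Big)^{-1-\frac{n-1}{n}}\qquad\text{for }0<|x|<1 .$$ (The value $u(0)$ is arbitrary.) Nonnegative admissible functions exist, and every admissible $u$ satisfies $u\in W^{1,1}(\mathbb{R}^n)$ and $\mathcal{S}u\notin W^{1,1}_{\rm loc}(\mathbb{R}^n)$. Moreover, there is a constant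 $C=C(n)>0$ such that for every admissible $u$ and all $x$ with $0<|x|\le 1$, $$\mathcal{S}u(x)\;\ge\;\frac{1}{\mathcal{H}^{n-1}(S^{n-1}(x,|x|))}\int_{S^{n-1}(x,|x|)}|u|\,d\mathcal{H}^{n-1}\;\ge\; C\,|x|^{1-n}\Big(\log\frac{e}{|x|}\Big)^{-\frac{n-1}{n}},$$ and the function $x\mapsto |x|^{1-n}\big(\log\frac{e}{|x|}\big)^{-\frac{n-1}{n}}$ does not belong to $L^{n/(n-1)}(U)$ for any neighbourhood $U$ of the origin. -/

import Mathlib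

open MeasureTheory Topology
open scoped ENNReal ContDiff

/-- `G` is the weak gradient of `u` on `ℝⁿ`: for every smooth compactly supported test function `φ`
and every coordinate `i`, `∫ u ∂ᵢφ = - ∫ Gᵢ φ`. Only used for locally integrable `u` and `G`. -/
def IsWeakGradient {n : ℕ} (u : EuclideanSpace ℝ (Fin n) → ℝ)
    (G : EuclideanSpace ℝ (Fin n) → EuclideanSpace ℝ (Fin n)) : Prop :=
  ∀ φ : EuclideanSpace ℝ (Fin n) → ℝ, ContDiff ℝ ∞ φ → HasCompactSupport φ →
    ∀ i : Fin n,
      ∫ x, u x * fderiv ℝ φ x (EuclideanSpace.single i 1) = - ∫ x, G x i * φ x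

/-- `u ∈ W^{1,1}(ℝⁿ)`: `u` is integrable and has an integrable weak gradient. -/
def MemW11 {n : ℕ} (u : EuclideanSpace ℝ (Fin n) → ℝ) : Prop :=
  Integrable u ∧
    ∃ G : EuclideanSpace ℝ (Fin n) → EuclideanSpace ℝ (Fin n),
      Integrable G ∧ IsWeakGradient u G

/-- `f ∈ W^{1,1}_loc(ℝⁿ)` for a function with values in `[0, ∞]`: `f` agrees almost everywhere with a
real-valued locally integrable function that has a locally integrable weak gradient. -/
def MemW11Loc {n : ℕ} (f : EuclideanSpace ℝ (Fin n) → ℝ≥0∞) : Prop :=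
  ∃ g : EuclideanSpace ℝ (Fin n) → ℝ,
    (∀ᵐ x, (f x : EReal) = (g x : EReal)) ∧ LocallyIntegrable g ∧
    ∃ G : EuclideanSpace ℝ (Fin n) → EuclideanSpace ℝ (Fin n),
      LocallyIntegrable G ∧ IsWeakGradient g G

/-- The average of `|u|` over the sphere `S^{n-1}(x, t)` with respect to the
`(n-1)`-dimensional Hausdorff measure. -/
noncomputable def sphericalAverage {n : ℕ} (u : EuclideanSpace ℝ (Fin n) → ℝ)
    (x : EuclideanSpace ℝ (Fin n)) (t : ℝ) : ℝ≥0∞ :=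
  ⨍⁻ z in Metric.sphere x t, ‖u z‖ₑ ∂μH[(n : ℝ) - 1]

/-- The spherical maximal function `S u`, with values in `[0, ∞]`. -/
noncomputable def sphericalMaximal {n : ℕ} (u : EuclideanSpace ℝ (Fin n) → ℝ)
    (x : EuclideanSpace ℝ (Fin n)) : ℝ≥0∞ :=
  ⨆ t : ℝ, ⨆ _ : 0 < t, sphericalAverage u x t

/-- The radial function `|x|^{1-n} (log (e/|x|))^{-α}`, used for `x ≠ 0`. -/
noncomputable def radialLog {n : ℕ} (α : ℝ) (x : EuclideanSpace ℝ (Fin n)) : ℝ :=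
  ‖x‖ ^ (1 - (n : ℝ)) * Real.log (Real.exp 1 / ‖x‖) ^ (-α)

/-- `u` is a compactly supported extension of `|x|^{1-n} (log (e/|x|))^{-1-(n-1)/n}` from the
punctured open unit ball to `ℝⁿ` that is smooth away from the origin. The value of `u` at the
origin, where the formula is singular, is arbitrary. -/
structure IsSmoothExtension {n : ℕ} (u : EuclideanSpace ℝ (Fin n) → ℝ) : Prop where
  eq_formula : ∀ x, 0 < ‖x‖ → ‖x‖ < 1 → u x = radialLog (1 + ((n : ℝ) - 1) / n) x
  smooth : ContDiffOn ℝ ∞ u {0}ᶜ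
  compact_support : HasCompactSupport u

open Set Filter Module
open scoped Convolution NNReal

/-! Write L = log(e/|x|) and β = (n-1)/n. Near 0 the functions u, u/|x| and |∇u| are all O(|x|^{-n}
L^{-1-β}), which is integrable because ∫ s⁻¹ log(e/s)^{-1-β} ds converges at 0. Cutting out small
balls around the origin shows that the classical gradient is the weak one
(`isWeakGradient_gradient`), so u is in W^{1,1}. The sphere about x of radius |x| passes through the
origin, where it is a graph over its tangent hyperplane with |z| comparable to |y|. There u is
comparable to |y|^{-(n-1)} log(e/|y|)^{-1-β}, again the critical power but now in dimension n-1. Its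
integral over |y| < |x|/2 is of order L^{-β}; division by the area, at most a constant times
|x|^{n-1}, gives the lower bound (`exists_le_sphericalAverage`). One power of the logarithm is thus
lost. The exponent n/(n-1) turns the lower bound into |x|^{-n} L^{-1}, whose integral diverges like
log log (`not_memLp_radialLog`), whereas the Gagliardo–Nirenberg–Sobolev inequality puts W^{1,1}_loc
inside L^{n/(n-1)}_loc (`memLp_ball_of_isWeakGradient`). -/

/-! ### One-variable calculus of powers of log(e/s). -/

lemma one_le_log_exp_one_div {s : ℝ} (hs : 0 < s) (hs1 : s ≤ 1) :
    1 ≤ Real.log (Real.exp 1 / s) := by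
  rw [Real.log_div (Real.exp_ne_zero _) hs.ne', Real.log_exp]
  linarith [Real.log_nonpos hs.le hs1]

lemma log_exp_one_div_pos {s : ℝ} (hs : 0 < s) (hs1 : s < Real.exp 1) :
    0 < Real.log (Real.exp 1 / s) :=
  Real.log_pos ((one_lt_div hs).2 hs1)

lemma hasDerivAt_log_exp_one_div {s : ℝ} (hs : 0 < s) :
    HasDerivAt (fun s ↦ Real.log (Real.exp 1 / s)) (-s⁻¹) s := by
  have h : HasDerivAt (fun s ↦ 1 - Real.log s) (-s⁻¹) s := by
    simpa using (Real.hasDerivAt_log hs.ne').const_sub 1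
  refine h.congr_of_eventuallyEq ?_
  filter_upwards [lt_mem_nhds hs] with t ht
  rw [Real.log_div (Real.exp_ne_zero _) ht.ne', Real.log_exp]

lemma tendsto_log_exp_one_div : Tendsto (fun s ↦ Real.log (Real.exp 1 / s)) (𝓝[>] 0) atTop :=
  Real.tendsto_log_atTop.comp
    (Tendsto.const_mul_atTop (Real.exp_pos 1) tendsto_inv_nhdsGT_zero)

lemma hasDerivAt_log_exp_one_div_rpow (γ : ℝ) {s : ℝ} (hs : 0 < s) (hs1 : s < Real.exp 1) :
    HasDerivAt (fun s ↦ Real.log (Real.exp 1 / s) ^ (-γ))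
      (γ * (s⁻¹ * Real.log (Real.exp 1 / s) ^ (-(1 + γ)))) s := by
  have := (hasDerivAt_log_exp_one_div hs).rpow_const (p := -γ)
    (Or.inl (log_exp_one_div_pos hs hs1).ne')
  convert! this using 1
  rw [show -γ - 1 = -(1 + γ) by ring]
  ring

/-- The endpoint 0 is included because the conventions e/0 = 0, log 0 = 0 and 0^{-β} = 0 give the
value 0, which is the true limit. -/
lemma continuousOn_log_exp_one_div_rpow {β ρ : ℝ} (hβ : 0 < β) (hρ : ρ < Real.exp 1) :
    ContinuousOn (fun s ↦ Real.log (Real.exp 1 / s) ^ (-β)) (Icc 0 ρ) := by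
  intro s hs
  rcases hs.1.eq_or_lt with rfl | h
  · have : Tendsto (fun s ↦ Real.log (Real.exp 1 / s) ^ (-β)) (𝓝[>] 0) (𝓝 0) :=
      (tendsto_rpow_neg_atTop hβ).comp tendsto_log_exp_one_div
    have h0 : ContinuousWithinAt (fun s ↦ Real.log (Real.exp 1 / s) ^ (-β)) (Ioi 0) 0 := by
      simpa [ContinuousWithinAt, Real.zero_rpow (neg_ne_zero.2 hβ.ne')] using this
    exact (continuousWithinAt_Ioi_iff_Ici.1 h0).mono Icc_subset_Ici_self
  · exact (hasDerivAt_log_exp_one_div_rpow β h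
      (hs.2.trans_lt hρ)).continuousAt.continuousWithinAt

/-- Up to the factor β the integrand is the nonnegative derivative of log(e/s)^{-β}, which is
continuous up to 0. -/
lemma intervalIntegrable_inv_mul_log_rpow {β ρ : ℝ} (hβ : 0 < β) (h0 : 0 ≤ ρ)
    (hρ : ρ < Real.exp 1) :
    IntervalIntegrable (fun s ↦ s⁻¹ * Real.log (Real.exp 1 / s) ^ (-(1 + β))) volume 0 ρ := by
  have := intervalIntegral.intervalIntegrable_deriv_of_nonneg (a := 0) (b := ρ)
    (g := fun s ↦ Real.log (Real.exp 1 / s) ^ (-β))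
    (g' := fun s ↦ β * (s⁻¹ * Real.log (Real.exp 1 / s) ^ (-(1 + β)))) ?_ ?_ ?_
  · simpa [← mul_assoc, hβ.ne'] using this.const_mul β⁻¹
  · rw [uIcc_of_le h0]
    exact continuousOn_log_exp_one_div_rpow hβ hρ
  · intro s hs
    rw [min_eq_left h0, max_eq_right h0] at hs
    exact hasDerivAt_log_exp_one_div_rpow β hs.1 (hs.2.trans hρ)
  · intro s hs
    rw [min_eq_left h0, max_eq_right h0] at hs
    have := log_exp_one_div_pos hs.1 (hs.2.trans hρ)
    have := hs.1
    positivity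

lemma integral_inv_mul_log_rpow {β ρ : ℝ} (hβ : 0 < β) (h0 : 0 ≤ ρ) (hρ : ρ < Real.exp 1) :
    ∫ s in (0 : ℝ)..ρ, s⁻¹ * Real.log (Real.exp 1 / s) ^ (-(1 + β)) =
      β⁻¹ * Real.log (Real.exp 1 / ρ) ^ (-β) := by
  have := intervalIntegral.integral_eq_sub_of_hasDerivAt_of_le h0
    (continuousOn_log_exp_one_div_rpow hβ hρ)
    (fun s hs ↦ hasDerivAt_log_exp_one_div_rpow β hs.1 (hs.2.trans hρ))
    ((intervalIntegrable_inv_mul_log_rpow hβ h0 hρ).const_mul β)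
  rw [intervalIntegral.integral_const_mul] at this
  rw [eq_inv_mul_iff_mul_eq₀ hβ.ne', this]
  simp [Real.zero_rpow (neg_ne_zero.2 hβ.ne')]

/-- Up to sign the antiderivative is log log(e/s), which is unbounded at 0. -/
lemma not_integrableOn_inv_mul_log_inv {ρ : ℝ} (hρ : 0 < ρ) :
    ¬ IntegrableOn (fun s ↦ s⁻¹ * Real.log (Real.exp 1 / s) ^ (-1 : ℝ)) (Ioo 0 ρ) := by
  have hd : ∀ᶠ s in 𝓝[>] (0 : ℝ), HasDerivAt (fun s ↦ Real.log (Real.log (Real.exp 1 / s)))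
      (-(s⁻¹ * Real.log (Real.exp 1 / s) ^ (-1 : ℝ))) s := by
    filter_upwards [Ioo_mem_nhdsGT (Real.exp_pos 1)] with s hs
    convert! (hasDerivAt_log_exp_one_div hs.1).log (log_exp_one_div_pos hs.1 hs.2).ne' using 1
    rw [Real.rpow_neg_one]
    ring
  refine not_integrableOn_of_tendsto_norm_atTop_of_deriv_isBigO_filter
    (f := fun s ↦ Real.log (Real.log (Real.exp 1 / s))) (𝓝[>] 0) (Ioo_mem_nhdsGT hρ)
    (hd.mono fun s h ↦ h.differentiableAt) ?_ ?_
  · exact tendsto_norm_atTop_atTop.comp (Real.tendsto_log_atTop.comp tendsto_log_exp_one_div)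
  · refine Asymptotics.IsBigO.of_bound 1 (hd.mono fun s h ↦ ?_)
    rw [h.deriv, norm_neg, one_mul]

lemma pow_mul_rpow_neg_nat {d : ℕ} (hd : 0 < d) {s : ℝ} (hs : 0 < s) (a : ℝ) :
    s ^ (d - 1) * (s ^ (-(d : ℝ)) * a) = s⁻¹ * a := by
  obtain ⟨k, rfl⟩ := Nat.exists_eq_succ_of_ne_zero hd.ne'
  rw [Real.rpow_neg hs.le, Real.rpow_natCast]
  simp only [Nat.succ_eq_add_one, Nat.add_sub_cancel]
  field_simp
  ring

/-! ### Polar coordinates for |x|^{-d} times a power of the logarithm. -/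

section Radial

variable {E : Type*} [NormedAddCommGroup E] [NormedSpace ℝ E] [FiniteDimensional ℝ E]
  [Nontrivial E] [MeasurableSpace E] [BorelSpace E] (μ : Measure E) [μ.IsAddHaarMeasure]

/-- The Jacobian s^{d-1} leaves s⁻¹ in every dimension. The measure is a general Haar measure so
that the result serves both for volume on ℝⁿ and for the Hausdorff measure on the tangent
hyperplane. -/
lemma integrableOn_ball_norm_rpow_mul_log_iff {γ ρ : ℝ} :
    IntegrableOn (fun x : E ↦ ‖x‖ ^ (-(finrank ℝ E : ℝ)) *
      Real.log (Real.exp 1 / ‖x‖) ^ (-γ)) (Metric.ball 0 ρ) μ ↔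
    IntegrableOn (fun s ↦ s⁻¹ * Real.log (Real.exp 1 / s) ^ (-γ)) (Ioo 0 ρ) := by
  rw [integrableOn_fun_norm_addHaar μ
    (f := fun s ↦ s ^ (-(finrank ℝ E : ℝ)) * Real.log (Real.exp 1 / s) ^ (-γ))]
  refine integrableOn_congr_fun (fun s hs ↦ ?_) measurableSet_Ioo
  exact pow_mul_rpow_neg_nat finrank_pos hs.1 _

lemma integrableOn_ball_norm_rpow_mul_log {β ρ : ℝ} (hβ : 0 < β) (hρ : ρ < Real.exp 1) :
    IntegrableOn (fun x : E ↦ ‖x‖ ^ (-(finrank ℝ E : ℝ)) *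
      Real.log (Real.exp 1 / ‖x‖) ^ (-(1 + β))) (Metric.ball 0 ρ) μ := by
  rcases le_or_gt 0 ρ with h0 | h0
  · rw [integrableOn_ball_norm_rpow_mul_log_iff, ← integrableOn_Ioc_iff_integrableOn_Ioo,
      ← intervalIntegrable_iff_integrableOn_Ioc_of_le h0]
    exact intervalIntegrable_inv_mul_log_rpow hβ h0 hρ
  · simp [Metric.ball_eq_empty.2 h0.le]

lemma setIntegral_ball_norm_rpow_mul_log {β ρ : ℝ} (hβ : 0 < β) (h0 : 0 ≤ ρ)
    (hρ : ρ < Real.exp 1) :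
    ∫ x in Metric.ball (0 : E) ρ, ‖x‖ ^ (-(finrank ℝ E : ℝ)) *
      Real.log (Real.exp 1 / ‖x‖) ^ (-(1 + β)) ∂μ =
    finrank ℝ E * μ.real (Metric.ball 0 1) *
      (β⁻¹ * Real.log (Real.exp 1 / ρ) ^ (-β)) := by
  have h1 : (Metric.ball (0 : E) ρ).indicator (fun x ↦ ‖x‖ ^ (-(finrank ℝ E : ℝ)) *
      Real.log (Real.exp 1 / ‖x‖) ^ (-(1 + β))) = fun x ↦ (Iio ρ).indicator
      (fun s ↦ s ^ (-(finrank ℝ E : ℝ)) * Real.log (Real.exp 1 / s) ^ (-(1 + β))) ‖x‖ := by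
    ext x
    simp [indicator]
  rw [← integral_indicator measurableSet_ball, h1, integral_fun_norm_addHaar μ,
    ← integral_inv_mul_log_rpow hβ h0 hρ, intervalIntegral.integral_of_le h0,
    integral_Ioc_eq_integral_Ioo, nsmul_eq_mul, smul_eq_mul, ← mul_assoc]
  congr 1
  rw [← integral_indicator measurableSet_Ioi, ← integral_indicator measurableSet_Ioo]
  congr 1
  ext s
  by_cases hs : 0 < s
  · by_cases hs' : s < ρ
    · simpa [hs, hs'] using pow_mul_rpow_neg_nat finrank_pos hs _
    · simp [hs, hs']
  · simp [hs]

end Radial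

lemma not_memLp_radialLog {n : ℕ} (hn : 2 ≤ n) {U : Set (EuclideanSpace ℝ (Fin n))}
    (hU : U ∈ 𝓝 0) :
    ¬ MemLp (radialLog (((n : ℝ) - 1) / n) : EuclideanSpace ℝ (Fin n) → ℝ)
      (ENNReal.ofReal ((n : ℝ) / ((n : ℝ) - 1))) (volume.restrict U) := by
  intro h
  obtain ⟨ρ, hρ, hρU⟩ := Metric.mem_nhds_iff.1 hU
  have hn2 : (2 : ℝ) ≤ n := by exact_mod_cast hn
  have hn1 : (0 : ℝ) < (n : ℝ) - 1 := by linarith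
  have : Nontrivial (EuclideanSpace ℝ (Fin n)) :=
    Module.nontrivial_of_finrank_pos (R := ℝ) (by simp; omega)
  -- Radius at most 1 keeps the logarithm at least 1, so the powers can be multiplied out.
  set r := min ρ 1
  have hr : 0 < r := lt_min hρ one_pos
  have h1 := h.mono_measure (Measure.restrict_mono
    ((Metric.ball_subset_ball (min_le_left ρ 1)).trans hρU) le_rfl)
  have hp : 0 < (n : ℝ) / (n - 1) := by positivity
  have h2 := h1.integrable_norm_rpow (by simpa using hp) (by simp)
  refine not_integrableOn_inv_mul_log_inv hr ?_
  rw [← integrableOn_ball_norm_rpow_mul_log_iff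
    (volume : Measure (EuclideanSpace ℝ (Fin n))) (γ := 1)]
  refine IntegrableOn.congr_fun h2 (fun x hx ↦ ?_) measurableSet_ball
  rw [ENNReal.toReal_ofReal hp.le, finrank_euclideanSpace_fin]
  rcases eq_or_ne x 0 with rfl | hx0
  · simp [radialLog, Real.zero_rpow, hn1.ne', sub_ne_zero.2 (show (1 : ℝ) ≠ n by linarith),
      show n ≠ 0 by omega, show (n : ℝ) / (n - 1) ≠ 0 from hp.ne']
  · have hx' : 0 < ‖x‖ := norm_pos_iff.2 hx0
    have hx1 : ‖x‖ < 1 := (mem_ball_zero_iff.1 hx).trans_le (min_le_right _ _)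
    have hl := one_le_log_exp_one_div hx' hx1.le
    simp only [radialLog]
    rw [Real.norm_of_nonneg (by positivity), Real.mul_rpow (by positivity) (by positivity),
      ← Real.rpow_mul hx'.le, ← Real.rpow_mul (by linarith)]
    congr 2 <;> (field_simp; try ring)

/-! ### Sobolev embedding for weak gradients, by mollification. -/

section Mollification

variable {n : ℕ}


lemma enorm_le_sum_enorm_single (L : EuclideanSpace ℝ (Fin n) →L[ℝ] ℝ) :
    ‖L‖ₑ ≤ ∑ i, ‖L (EuclideanSpace.single i 1)‖ₑ := by
  have h : ‖L‖ ≤ ∑ i, ‖L (EuclideanSpace.single i 1)‖ := by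
    refine L.opNorm_le_bound (Finset.sum_nonneg fun i _ ↦ norm_nonneg _) fun x ↦ ?_
    have hx : x = ∑ i, x i • EuclideanSpace.single i (1 : ℝ) := by
      simpa using ((EuclideanSpace.basisFun (Fin n) ℝ).sum_repr x).symm
    conv_lhs => rw [hx, map_sum]
    rw [Finset.sum_mul]
    refine (norm_sum_le _ _).trans (Finset.sum_le_sum fun i _ ↦ ?_)
    rw [map_smul, norm_smul, mul_comm]
    gcongr
    exact PiLp.norm_apply_le x i
  have h' : ‖L‖₊ ≤ ∑ i, ‖L (EuclideanSpace.single i 1)‖₊ := by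
    rw [← NNReal.coe_le_coe]; simpa using h
  simpa [enorm_eq_nnnorm] using ENNReal.coe_le_coe.2 h'

variable {v : EuclideanSpace ℝ (Fin n) → ℝ} {V : EuclideanSpace ℝ (Fin n) → EuclideanSpace ℝ (Fin n)}

/-- The derivative falls on the bump, and t ↦ φ(x - t) is an admissible test function; the sign from
x - t cancels the one in `IsWeakGradient`. -/
lemma fderiv_convolution_normed_single (φ : ContDiffBump (0 : EuclideanSpace ℝ (Fin n))) (hv : LocallyIntegrable v)
    (hvV : IsWeakGradient v V) (x : EuclideanSpace ℝ (Fin n)) (i : Fin n) :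
    fderiv ℝ (φ.normed volume ⋆[ContinuousLinearMap.lsmul ℝ ℝ, volume] v) x
      (EuclideanSpace.single i 1) = ∫ t, V t i * φ.normed volume (x - t) := by
  have hc : HasCompactSupport (φ.normed (volume : Measure (EuclideanSpace ℝ (Fin n)))) := φ.hasCompactSupport_normed
  have hs : ContDiff ℝ 1 (φ.normed (volume : Measure (EuclideanSpace ℝ (Fin n)))) := by
    exact_mod_cast φ.contDiff_normed (n := 1)
  rw [(hc.hasFDerivAt_convolution_left (ContinuousLinearMap.lsmul ℝ ℝ) hs hv x).fderiv,
    convolution_eq_swap]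
  have hint : Integrable fun t ↦ ((ContinuousLinearMap.lsmul ℝ ℝ).precompL (EuclideanSpace ℝ (Fin n))
      (fderiv ℝ (φ.normed (volume : Measure (EuclideanSpace ℝ (Fin n)))) (x - t))) (v t) := by
    have := (hc.fderiv (𝕜 := ℝ)).convolutionExists_left ((ContinuousLinearMap.lsmul ℝ ℝ :
      ℝ →L[ℝ] ℝ →L[ℝ] ℝ).precompL (EuclideanSpace ℝ (Fin n))) (hs.continuous_fderiv one_ne_zero) hv x
    exact this.integrable_swap
  refine (ContinuousLinearMap.integral_apply hint _).trans ?_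
  have hs' : ContDiff ℝ ∞ fun t ↦ φ.normed (volume : Measure (EuclideanSpace ℝ (Fin n))) (x - t) :=
    (φ.contDiff_normed (n := ⊤)).comp (contDiff_const.sub contDiff_id)
  have hc' : HasCompactSupport fun t ↦ φ.normed (volume : Measure (EuclideanSpace ℝ (Fin n))) (x - t) :=
    hc.comp_homeomorph (Homeomorph.subLeft x)
  have := hvV _ hs' hc' i
  rw [← neg_eq_iff_eq_neg, ← integral_neg] at this
  rw [← this]
  congr 1
  ext t
  have hd : HasFDerivAt (fun t ↦ φ.normed (volume : Measure (EuclideanSpace ℝ (Fin n))) (x - t))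
      ((fderiv ℝ (φ.normed (volume : Measure (EuclideanSpace ℝ (Fin n)))) (x - t)).comp
        (-(ContinuousLinearMap.id ℝ (EuclideanSpace ℝ (Fin n))))) t :=
    ((hs.differentiable one_ne_zero) (x - t)).hasFDerivAt.comp t
      ((hasFDerivAt_id t).const_sub x)
  rw [hd.fderiv]
  simp [mul_comm]

/-- Tonelli, and the bump is nonnegative with integral 1. -/
lemma lintegral_enorm_integral_mul_normed_le (φ : ContDiffBump (0 : EuclideanSpace ℝ (Fin n))) {w : EuclideanSpace ℝ (Fin n) → ℝ}
    (hw : AEStronglyMeasurable w) :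
    ∫⁻ x, ‖∫ t, w t * φ.normed volume (x - t)‖ₑ ≤ ∫⁻ t, ‖w t‖ₑ := by
  have hφ : Continuous (φ.normed (volume : Measure (EuclideanSpace ℝ (Fin n)))) := φ.continuous_normed
  calc ∫⁻ x, ‖∫ t, w t * φ.normed volume (x - t)‖ₑ
      ≤ ∫⁻ x, ∫⁻ t, ‖w t‖ₑ * ‖φ.normed volume (x - t)‖ₑ := by
        refine lintegral_mono fun x ↦ (enorm_integral_le_lintegral_enorm _).trans ?_
        simp [enorm_mul]
    _ = ∫⁻ t, ∫⁻ x, ‖w t‖ₑ * ‖φ.normed volume (x - t)‖ₑ := by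
        refine lintegral_lintegral_swap ?_
        refine AEMeasurable.mul (M := ℝ≥0∞) ?_ ?_
        · exact hw.enorm.comp_snd
        · exact (by fun_prop : Continuous fun p : EuclideanSpace ℝ (Fin n) × EuclideanSpace ℝ (Fin n) ↦
            ‖φ.normed (volume : Measure (EuclideanSpace ℝ (Fin n))) (p.1 - p.2)‖ₑ).measurable.aemeasurable
    _ = ∫⁻ t, ‖w t‖ₑ := by
        refine lintegral_congr fun t ↦ ?_
        rw [lintegral_const_mul' _ _ enorm_ne_top,
          lintegral_sub_right_eq_self (fun y ↦ ‖φ.normed (volume : Measure (EuclideanSpace ℝ (Fin n))) y‖ₑ) t,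
          ← ofReal_integral_norm_eq_lintegral_enorm φ.integrable_normed]
        simp [Real.norm_of_nonneg (φ.nonneg_normed _), φ.integral_normed]

/-- The Gagliardo–Nirenberg–Sobolev embedding for compactly supported functions with an integrable
weak gradient. -/
lemma eLpNorm_lt_top_of_isWeakGradient (hv : Integrable v) (hV : Integrable V)
    (hvV : IsWeakGradient v V) (hc : HasCompactSupport v) {p : ℝ≥0}
    (hp : NNReal.HolderConjugate (finrank ℝ (EuclideanSpace ℝ (Fin n))) p) : eLpNorm v p volume < ⊤ := by
  -- The bounded ratio of radii is what the almost everywhere convergence of the mollifications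
  -- requires.
  obtain ⟨φ, hφ, hφ'⟩ : ∃ φ : ℕ → ContDiffBump (0 : EuclideanSpace ℝ (Fin n)), (∀ k, (φ k).rOut = 2 * (φ k).rIn) ∧
      Tendsto (fun k ↦ (φ k).rOut) atTop (𝓝 0) := by
    refine ⟨fun k ↦ ⟨1 / ((k : ℝ) + 1), 2 * (1 / ((k : ℝ) + 1)), by positivity, ?_⟩,
      fun k ↦ rfl, ?_⟩
    · have : 0 < 1 / ((k : ℝ) + 1) := by positivity
      linarith
    · simpa using tendsto_one_div_add_atTop_nhds_zero_nat.const_mul (2 : ℝ)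
  have hlim := ContDiffBump.ae_convolution_tendsto_right_of_locallyIntegrable (K := 2) hφ'
    (Eventually.of_forall fun k ↦ (hφ k).le) hv.locallyIntegrable
  set c := fun k ↦ (φ k).normed volume ⋆[ContinuousLinearMap.lsmul ℝ ℝ, volume] v
  have hcd : ∀ k, ContDiff ℝ 1 (c k) := fun k ↦ by
    exact_mod_cast (φ k).hasCompactSupport_normed.contDiff_convolution_left
      (ContinuousLinearMap.lsmul ℝ ℝ) ((φ k).contDiff_normed (n := 1)) hv.locallyIntegrable
  have hcc : ∀ k, HasCompactSupport (c k) := fun k ↦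
    (φ k).hasCompactSupport_normed.convolution (ContinuousLinearMap.lsmul ℝ ℝ) hc
  have hVi : ∀ i, Integrable fun x ↦ V x i := fun i ↦
    (EuclideanSpace.proj (𝕜 := ℝ) i).integrable_comp hV
  have hbound : ∀ k, eLpNorm (c k) p volume ≤ eLpNormLESNormFDerivOneConst (volume : Measure (EuclideanSpace ℝ (Fin n))) p *
      ∑ i, ∫⁻ x, ‖V x i‖ₑ := by
    intro k
    refine (eLpNorm_le_eLpNorm_fderiv_one volume (hcd k) (hcc k) hp).trans ?_
    gcongr
    rw [eLpNorm_one_eq_lintegral_enorm]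
    calc ∫⁻ x, ‖fderiv ℝ (c k) x‖ₑ
        ≤ ∫⁻ x, ∑ i, ‖fderiv ℝ (c k) x (EuclideanSpace.single i 1)‖ₑ :=
          lintegral_mono fun x ↦ enorm_le_sum_enorm_single _
      _ = ∑ i, ∫⁻ x, ‖fderiv ℝ (c k) x (EuclideanSpace.single i 1)‖ₑ := by
          refine lintegral_finsetSum _ fun i _ ↦ Continuous.measurable ?_
          exact (((hcd k).continuous_fderiv one_ne_zero).clm_apply continuous_const).enorm
      _ ≤ _ := by
          refine Finset.sum_le_sum fun i _ ↦ ?_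
          simp_rw [c, fderiv_convolution_normed_single (φ k) hv.locallyIntegrable hvV]
          exact lintegral_enorm_integral_mul_normed_le (φ k) (hVi i).aestronglyMeasurable
  -- Fatou: the bound is uniform in k and passes to the almost everywhere limit.
  refine (Lp.eLpNorm_lim_le_liminf_eLpNorm
    (fun k ↦ (hcd k).continuous.aestronglyMeasurable) v hlim).trans_lt ?_
  have hfin : eLpNormLESNormFDerivOneConst (volume : Measure (EuclideanSpace ℝ (Fin n))) p *
      ∑ i, ∫⁻ x, ‖V x i‖ₑ < ⊤ :=
    ENNReal.mul_lt_top ENNReal.coe_lt_top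
      (ENNReal.sum_lt_top.2 fun i _ ↦ (hVi i).hasFiniteIntegral)
  refine (liminf_le_of_le (by isBoundedDefault) fun b hb ↦ ?_).trans_lt hfin
  obtain ⟨k, hk⟩ := hb.exists
  exact hk.trans (hbound k)

/-- Product rule, obtained by testing the weak gradient of v against χφ. -/
lemma IsWeakGradient.mul_contDiff (hv : LocallyIntegrable v) (hV : LocallyIntegrable V)
    (hvV : IsWeakGradient v V) {χ : EuclideanSpace ℝ (Fin n) → ℝ} (hχ : ContDiff ℝ ∞ χ) (hχc : HasCompactSupport χ) :
    IsWeakGradient (fun x ↦ χ x * v x) (fun x ↦ χ x • V x + v x • gradient χ x) := by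
  intro φ hφ hφc i
  have hVi : LocallyIntegrable fun x ↦ V x i := fun x ↦
    (hV x).imp fun s hs ↦ ⟨hs.1, (EuclideanSpace.proj (𝕜 := ℝ) i).integrable_comp hs.2⟩
  have h := hvV (fun x ↦ χ x * φ x) (hχ.mul hφ) hχc.mul_right i
  have hd : ∀ x, fderiv ℝ (fun x ↦ χ x * φ x) x (EuclideanSpace.single i 1) =
      χ x * fderiv ℝ φ x (EuclideanSpace.single i 1) +
      φ x * fderiv ℝ χ x (EuclideanSpace.single i 1) := fun x ↦ by
    rw [fderiv_fun_mul ((hχ.differentiable (by simp)) x) ((hφ.differentiable (by simp)) x)]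
    simp
  have hcχ := hχ.continuous
  have hcφ := hφ.continuous
  have hcχ' : Continuous fun x ↦ fderiv ℝ χ x (EuclideanSpace.single i 1) :=
    (hχ.continuous_fderiv (by simp)).clm_apply continuous_const
  have hcφ' : Continuous fun x ↦ fderiv ℝ φ x (EuclideanSpace.single i 1) :=
    (hφ.continuous_fderiv (by simp)).clm_apply continuous_const
  have i1 : Integrable fun x ↦ (χ x * fderiv ℝ φ x (EuclideanSpace.single i 1)) • v x :=
    hv.integrable_smul_left_of_hasCompactSupport (hcχ.mul hcφ') hχc.mul_right
  have i2 : Integrable fun x ↦ (φ x * fderiv ℝ χ x (EuclideanSpace.single i 1)) • v x :=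
    hv.integrable_smul_left_of_hasCompactSupport (hcφ.mul hcχ') hφc.mul_right
  have i3 : Integrable fun x ↦ (χ x * φ x) • V x i :=
    hVi.integrable_smul_left_of_hasCompactSupport (hcχ.mul hcφ) hχc.mul_right
  have hg : ∀ x, gradient χ x i = fderiv ℝ χ x (EuclideanSpace.single i 1) := fun x ↦ by
    rw [← inner_gradient_left, EuclideanSpace.inner_single_right]
    simp
  simp_rw [hd] at h
  simp only [PiLp.add_apply, PiLp.smul_apply, hg, smul_eq_mul] at i1 i2 i3 ⊢
  have e1 : ∫ x, χ x * v x * fderiv ℝ φ x (EuclideanSpace.single i 1) =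
      ∫ x, χ x * fderiv ℝ φ x (EuclideanSpace.single i 1) * v x := by
    congr 1; ext x; ring
  have e2 : ∫ x, (χ x * V x i + v x * fderiv ℝ χ x (EuclideanSpace.single i 1)) * φ x =
      (∫ x, χ x * φ x * V x i) +
      ∫ x, φ x * fderiv ℝ χ x (EuclideanSpace.single i 1) * v x := by
    rw [← integral_add i3 i2]; congr 1; ext x; ring
  have e3 : ∫ x, v x * (χ x * fderiv ℝ φ x (EuclideanSpace.single i 1) +
      φ x * fderiv ℝ χ x (EuclideanSpace.single i 1)) =
      (∫ x, χ x * fderiv ℝ φ x (EuclideanSpace.single i 1) * v x) +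
      ∫ x, φ x * fderiv ℝ χ x (EuclideanSpace.single i 1) * v x := by
    rw [← integral_add i1 i2]; congr 1; ext x; ring
  have e4 : ∫ x, V x i * (χ x * φ x) = ∫ x, χ x * φ x * V x i := by
    congr 1; ext x; ring
  linarith

/-- A cutoff equal to 1 on the unit ball reduces to the compactly supported case without changing v
there. -/
lemma memLp_ball_of_isWeakGradient (hv : LocallyIntegrable v) (hV : LocallyIntegrable V)
    (hvV : IsWeakGradient v V) {p : ℝ≥0} (hp : NNReal.HolderConjugate (finrank ℝ (EuclideanSpace ℝ (Fin n))) p) :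
    MemLp v p (volume.restrict (Metric.ball 0 1)) := by
  refine ⟨hv.aestronglyMeasurable.restrict, ?_⟩
  let χ : ContDiffBump (0 : EuclideanSpace ℝ (Fin n)) := ⟨1, 2, one_pos, one_lt_two⟩
  have hχ : ContDiff ℝ ∞ χ := χ.contDiff
  have hχc : HasCompactSupport χ := χ.hasCompactSupport
  have hgc : Continuous (gradient χ) :=
    (InnerProductSpace.toDual ℝ (EuclideanSpace ℝ (Fin n))).symm.continuous.comp (hχ.continuous_fderiv (by simp))
  have hgs : HasCompactSupport (gradient χ) :=
    (hχc.fderiv (𝕜 := ℝ)).comp_left (map_zero (InnerProductSpace.toDual ℝ (EuclideanSpace ℝ (Fin n))).symm)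
  have h := eLpNorm_lt_top_of_isWeakGradient (v := fun x ↦ χ x * v x)
    (hv.integrable_smul_left_of_hasCompactSupport hχ.continuous hχc)
    ((hV.integrable_smul_left_of_hasCompactSupport hχ.continuous hχc).add
      (hv.integrable_smul_right_of_hasCompactSupport hgc hgs))
    (hvV.mul_contDiff hv hV hχ hχc) hχc.mul_right hp
  refine (eLpNorm_mono_ae ?_).trans_lt ((eLpNorm_restrict_le _ _ _ (Metric.ball 0 1)).trans_lt h)
  refine (ae_restrict_iff' measurableSet_ball).2 (Eventually.of_forall fun x hx ↦ ?_)
  rw [χ.one_of_mem_closedBall (Metric.ball_subset_closedBall hx), one_mul]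

end Mollification

/-! ### Hausdorff measure on spheres and the average over the sphere through the origin. -/

section Sphere

variable {m : ℕ}

/-- Coordinates on the orthogonal complement of e: J embeds it and Q projects onto it. They present
the sphere as a graph, and Q, being 1-Lipschitz, compares Hausdorff measures. -/
lemma exists_orthogonal_splitting {e : EuclideanSpace ℝ (Fin (m + 1))} (he : ‖e‖ = 1) :
    ∃ (J : EuclideanSpace ℝ (Fin m) →ₗᵢ[ℝ] EuclideanSpace ℝ (Fin (m + 1)))
      (Q : EuclideanSpace ℝ (Fin (m + 1)) →L[ℝ] EuclideanSpace ℝ (Fin m)),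
      (∀ y, inner ℝ e (J y) = 0) ∧ (∀ y, Q (J y) = y) ∧ Q e = 0 ∧
      (∀ w, J (Q w) + inner ℝ e w • e = w) ∧ LipschitzWith 1 Q := by
  have hfact : Fact (finrank ℝ (EuclideanSpace ℝ (Fin (m + 1))) = m + 1) := ⟨by simp⟩
  have he0 : e ≠ 0 := by rintro rfl; simp at he
  let b := OrthonormalBasis.fromOrthogonalSpanSingleton (𝕜 := ℝ) m he0
  refine ⟨(Submodule.subtypeₗᵢ _).comp b.repr.symm.toLinearIsometry,
    (b.repr.toContinuousLinearEquiv : _ →L[ℝ] _).comp ((ℝ ∙ e)ᗮ).orthogonalProjectionOnto,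
    fun y ↦ ?_, fun y ↦ ?_, ?_, fun w ↦ ?_, ?_⟩
  · exact Submodule.mem_orthogonal_singleton_iff_inner_right.1 (b.repr.symm y).2
  · simp
  · simp
  · have h := Submodule.starProjection_add_starProjection_orthogonal (K := ℝ ∙ e) w
    rw [Submodule.starProjection_unit_singleton ℝ he] at h
    calc _ = (ℝ ∙ e)ᗮ.starProjection w + inner ℝ e w • e := by simp
      _ = w := (add_comm _ _).trans h
  · refine LipschitzWith.of_dist_le_mul fun x y ↦ ?_
    rw [dist_eq_norm, dist_eq_norm, ← map_sub, NNReal.coe_one, one_mul]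
    change ‖b.repr ((ℝ ∙ e)ᗮ.orthogonalProjectionOnto (x - y))‖ ≤ _
    rw [LinearIsometryEquiv.norm_map]
    exact Submodule.norm_orthogonalProjectionOnto_apply_le (ℝ ∙ e)ᗮ (x - y)

lemma norm_sq_add_smul_of_inner_eq_zero {F : Type*} [NormedAddCommGroup F] [InnerProductSpace ℝ F]
    {e v : F} (he : ‖e‖ = 1) (hv : inner ℝ e v = 0) (t : ℝ) :
    ‖v + t • e‖ ^ 2 = ‖v‖ ^ 2 + t ^ 2 := by
  have := norm_add_sq_eq_norm_sq_add_norm_sq_of_inner_eq_zero v (t • e)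
    (by rw [inner_smul_right, real_inner_comm, hv, mul_zero])
  rw [sq, this, norm_smul, he, mul_one, Real.norm_eq_abs, abs_mul_abs_self, ← sq, ← sq]

instance isAddHaarMeasure_hausdorffMeasure_natCast :
    (μH[(m : ℝ)] : Measure (EuclideanSpace ℝ (Fin m))).IsAddHaarMeasure := by
  have := isAddHaarMeasure_hausdorffMeasure (E := EuclideanSpace ℝ (Fin m))
  rwa [finrank_euclideanSpace_fin] at this

/-- By compactness a local bound suffices. Near e the sphere is the graph of √(1 - |y|²), a C¹ and
hence locally Lipschitz image of a bounded set. -/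
lemma hausdorffMeasure_unit_sphere_lt_top :
    μH[(m : ℝ)] (Metric.sphere (0 : EuclideanSpace ℝ (Fin (m + 1))) 1) < ⊤ := by
  refine (isCompact_sphere 0 1).measure_lt_top_of_nhdsWithin fun e he ↦ ?_
  rw [mem_sphere_zero_iff_norm] at he
  obtain ⟨J, Q, hJ, hQJ, hQe, hdec, -⟩ := exists_orthogonal_splitting he
  let f : EuclideanSpace ℝ (Fin m) → EuclideanSpace ℝ (Fin (m + 1)) :=
    fun y ↦ J y + √(1 - ‖y‖ ^ 2) • e
  have hf : ContDiffAt ℝ 1 f 0 := by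
    refine J.contDiff.contDiffAt.add (ContDiffAt.fun_smul ?_ contDiffAt_const)
    exact (contDiffAt_const.sub (contDiff_norm_sq ℝ).contDiffAt).sqrt (by simp)
  obtain ⟨K, t, ht, hK⟩ := hf.exists_lipschitzOnWith
  let t' := t ∩ Metric.ball 0 1
  have ht' : t' ∈ 𝓝 0 := inter_mem ht (Metric.ball_mem_nhds _ one_pos)
  refine ⟨f '' t', ?_, ?_⟩
  · have h1 : Q ⁻¹' t' ∈ 𝓝 e := Q.continuous.continuousAt (by rwa [hQe])
    have h2 : {w | 0 < inner ℝ e w} ∈ 𝓝 e :=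
      (isOpen_lt continuous_const (by fun_prop)).mem_nhds (by simp [he])
    filter_upwards [mem_nhdsWithin_of_mem_nhds h1, mem_nhdsWithin_of_mem_nhds h2,
      self_mem_nhdsWithin] with w hw1 (hw2 : 0 < inner ℝ e w) hw3
    refine ⟨Q w, hw1, ?_⟩
    have hn := norm_sq_add_smul_of_inner_eq_zero he (hJ (Q w)) (inner ℝ e w)
    rw [hdec, mem_sphere_zero_iff_norm.1 hw3, J.norm_map] at hn
    have : √(1 - ‖Q w‖ ^ 2) = inner ℝ e w := by
      rw [← Real.sqrt_sq hw2.le]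
      congr 1
      linarith
    simp only [f, this, hdec]
  · refine ((hK.mono inter_subset_left).hausdorffMeasure_image_le m.cast_nonneg).trans_lt ?_
    refine ENNReal.mul_lt_top (ENNReal.rpow_lt_top_of_nonneg m.cast_nonneg ENNReal.coe_ne_top) ?_
    exact (measure_mono inter_subset_right).trans_lt Metric.isBounded_ball.measure_lt_top

/-- Dilation is Lipschitz. An upper bound suffices, as the area only enters as a denominator. -/
lemma hausdorffMeasure_sphere_le (x : EuclideanSpace ℝ (Fin (m + 1))) {r : ℝ} (hr : 0 < r) :
    μH[(m : ℝ)] (Metric.sphere x r) ≤ ENNReal.ofReal (r ^ m) *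
      μH[(m : ℝ)] (Metric.sphere (0 : EuclideanSpace ℝ (Fin (m + 1))) 1) := by
  have hL : LipschitzWith r.toNNReal fun z : EuclideanSpace ℝ (Fin (m + 1)) ↦ x + r • z := by
    refine LipschitzWith.of_dist_le_mul fun y z ↦ ?_
    rw [dist_add_left, dist_smul₀, Real.norm_of_nonneg hr.le, Real.coe_toNNReal _ hr.le]
  have himage : Metric.sphere x r ⊆ (fun z ↦ x + r • z) '' Metric.sphere 0 1 := by
    intro z hz
    refine ⟨r⁻¹ • (z - x), ?_, by simp [smul_smul, hr.ne']⟩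
    rw [mem_sphere_iff_norm] at hz
    simp [norm_smul, hz, abs_of_pos hr, hr.ne']
  refine (measure_mono himage).trans ((hL.hausdorffMeasure_image_le m.cast_nonneg _).trans_eq ?_)
  rw [ENNReal.rpow_natCast, ENNReal.ofReal_pow hr.le]
  rfl

/-- A 1-Lipschitz map with a continuous section does not decrease integrals with respect to the
Hausdorff measure when they are pulled back along the section. -/
lemma setLIntegral_hausdorffMeasure_le_of_section {X Y : Type*} [MetricSpace X]
    [MeasurableSpace X] [BorelSpace X] [MetricSpace Y] [MeasurableSpace Y] [BorelSpace Y]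
    {d : ℝ} (hd : 0 ≤ d) {Q : X → Y} (hQ : LipschitzWith 1 Q) {σ : Y → X} (hσ : Continuous σ)
    (hQσ : ∀ y, Q (σ y) = y) {B : Set Y} (hB : IsCompact B) {S : Set X} (hBS : MapsTo σ B S)
    {g : Y → ℝ≥0∞} (hg : Measurable g) {f : X → ℝ≥0∞} (hgf : ∀ y ∈ B, g y ≤ f (σ y)) :
    ∫⁻ y in B, g y ∂μH[d] ≤ ∫⁻ z in S, f z ∂μH[d] := by
  have hA : MeasurableSet (σ '' B) := (hB.image hσ).measurableSet
  have hle : (μH[d]).restrict B ≤ Measure.map Q ((μH[d]).restrict (σ '' B)) := by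
    refine Measure.le_iff.2 fun D hD ↦ ?_
    rw [Measure.map_apply hQ.continuous.measurable hD, Measure.restrict_apply hD,
      Measure.restrict_apply (hQ.continuous.measurable hD)]
    calc μH[d] (D ∩ B) ≤ μH[d] (Q '' (Q ⁻¹' D ∩ σ '' B)) := by
          refine measure_mono fun y hy ↦ ⟨σ y, ⟨?_, mem_image_of_mem σ hy.2⟩, hQσ y⟩
          rw [mem_preimage, hQσ]
          exact hy.1
      _ ≤ μH[d] (Q ⁻¹' D ∩ σ '' B) := by
          simpa using hQ.hausdorffMeasure_image_le hd (Q ⁻¹' D ∩ σ '' B)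
  calc ∫⁻ y in B, g y ∂μH[d]
      ≤ ∫⁻ y, g y ∂(Measure.map Q ((μH[d]).restrict (σ '' B))) := lintegral_mono' hle le_rfl
    _ = ∫⁻ z in σ '' B, g (Q z) ∂μH[d] := lintegral_map hg hQ.continuous.measurable
    _ ≤ ∫⁻ z in σ '' B, f z ∂μH[d] := by
        refine setLIntegral_mono' hA ?_
        rintro _ ⟨y, hy, rfl⟩
        rw [hQσ]
        exact hgf y hy
    _ ≤ ∫⁻ z in S, f z ∂μH[d] := lintegral_mono_set hBS.image_subset

/-- The quantity is the height of a sphere of radius r over its tangent hyperplane, at distance y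
from the point of contact. -/
lemma sub_sqrt_sq_sub_sq_mem_Icc {r y : ℝ} (hy : 0 ≤ y) (hyr : y ≤ r) :
    0 ≤ r - √(r ^ 2 - y ^ 2) ∧ r - √(r ^ 2 - y ^ 2) ≤ y := by
  constructor
  · have : √(r ^ 2 - y ^ 2) ≤ r := Real.sqrt_le_iff.2 ⟨hy.trans hyr, by nlinarith⟩
    linarith
  · have : r - y ≤ √(r ^ 2 - y ^ 2) := Real.le_sqrt_of_sq_le (by nlinarith)
    linarith

/-- The two factors have opposite monotonicity in ‖z‖: the power is bounded at the end 2a, which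
costs 2^{-m}, and the logarithm at the end a. -/
lemma rpow_mul_log_le_radialLog {a γ : ℝ} (hγ : 0 ≤ γ) (ha : 0 < a)
    {z : EuclideanSpace ℝ (Fin (m + 1))} (haz : a ≤ ‖z‖) (hza : ‖z‖ ≤ 2 * a) (hz : ‖z‖ ≤ 1) :
    (2 : ℝ) ^ (-(m : ℝ)) * (a ^ (-(m : ℝ)) * Real.log (Real.exp 1 / a) ^ (-γ)) ≤ radialLog γ z := by
  have hz0 : 0 < ‖z‖ := ha.trans_le haz
  have h1 := one_le_log_exp_one_div hz0 hz
  have h2 : Real.log (Real.exp 1 / ‖z‖) ≤ Real.log (Real.exp 1 / a) :=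
    Real.log_le_log (by positivity) (by gcongr)
  rw [radialLog, ← mul_assoc, ← Real.mul_rpow zero_le_two ha.le,
    show (1 : ℝ) - ((m + 1 : ℕ) : ℝ) = -(m : ℝ) by push_cast; ring]
  refine mul_le_mul ?_ ?_ (Real.rpow_nonneg (by linarith) _) (by positivity)
  · exact Real.rpow_le_rpow_of_nonpos hz0 hza (by simp)
  · exact Real.rpow_le_rpow_of_nonpos (by linarith) h2 (by linarith)

/-- The cap of the sphere near 0 is parametrised over its tangent hyperplane, the orthogonal
complement of x; its projection is 1-Lipschitz, so no area formula is needed. -/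
lemma setLIntegral_ball_le_setLIntegral_sphere (hm : 0 < m) {γ : ℝ} (hγ : 0 ≤ γ)
    {u : EuclideanSpace ℝ (Fin (m + 1)) → ℝ}
    (hu : ∀ x, 0 < ‖x‖ → ‖x‖ < 1 → u x = radialLog γ x)
    {x : EuclideanSpace ℝ (Fin (m + 1))} (hx : 0 < ‖x‖) (hx1 : ‖x‖ ≤ 1) :
    ∫⁻ y in Metric.closedBall (0 : EuclideanSpace ℝ (Fin m)) (‖x‖ / 2),
      ENNReal.ofReal ((2 : ℝ) ^ (-(m : ℝ)) * (‖y‖ ^ (-(m : ℝ)) *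
        Real.log (Real.exp 1 / ‖y‖) ^ (-γ))) ∂μH[(m : ℝ)] ≤
    ∫⁻ z in Metric.sphere x ‖x‖, ‖u z‖ₑ ∂μH[(m : ℝ)] := by
  set r := ‖x‖ with hr
  obtain ⟨e, he, hxe⟩ : ∃ e : EuclideanSpace ℝ (Fin (m + 1)), ‖e‖ = 1 ∧ r • e = x :=
    ⟨r⁻¹ • x, by rw [norm_smul, ← hr, norm_inv, Real.norm_of_nonneg hx.le, inv_mul_cancel₀ hx.ne'],
      by rw [smul_smul, mul_inv_cancel₀ hx.ne', one_smul]⟩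
  obtain ⟨J, Q, hJ, hQJ, hQe, -, hQ⟩ := exists_orthogonal_splitting he
  refine setLIntegral_hausdorffMeasure_le_of_section m.cast_nonneg hQ
    (σ := fun y ↦ J y + (r - √(r ^ 2 - ‖y‖ ^ 2)) • e)
    (by have := J.continuous; fun_prop) (fun y ↦ by simp [hQJ, hQe]) (isCompact_closedBall _ _)
    (fun y hy ↦ ?_) (by fun_prop) fun y hy ↦ ?_
  all_goals rw [mem_closedBall_zero_iff] at hy
  · have hn : ‖J y + -√(r ^ 2 - ‖y‖ ^ 2) • e‖ ^ 2 = r ^ 2 := by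
      rw [norm_sq_add_smul_of_inner_eq_zero he (hJ y), J.norm_map, neg_sq, Real.sq_sqrt]
      · ring
      · nlinarith [norm_nonneg y]
    have hsub : J y + (r - √(r ^ 2 - ‖y‖ ^ 2)) • e - x = J y + -√(r ^ 2 - ‖y‖ ^ 2) • e := by
      rw [← hxe]
      module
    rw [mem_sphere_iff_norm, ← sq_eq_sq₀ (norm_nonneg _) hx.le, hsub, hn]
  · rcases eq_or_ne y 0 with rfl | hy0
    · simp [hm.ne']
    · have hy' : 0 < ‖y‖ := norm_pos_iff.2 hy0
      set z := J y + (r - √(r ^ 2 - ‖y‖ ^ 2)) • e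
      obtain ⟨h1, h2⟩ := sub_sqrt_sq_sub_sq_mem_Icc hy'.le (by linarith : ‖y‖ ≤ r)
      have hz : ‖z‖ ^ 2 = ‖y‖ ^ 2 + (r - √(r ^ 2 - ‖y‖ ^ 2)) ^ 2 := by
        rw [norm_sq_add_smul_of_inner_eq_zero he (hJ y), J.norm_map]
      have h3 := pow_le_pow_left₀ h1 h2 2
      have hyz : ‖y‖ ≤ ‖z‖ := le_of_sq_le_sq (by nlinarith) (norm_nonneg z)
      have hzy : ‖z‖ ≤ 2 * ‖y‖ := le_of_sq_le_sq (by nlinarith) (by positivity)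
      -- Here |z|² ≤ 2|y|² ≤ r²/2, so the formula for u applies even when r = 1.
      have hz1 : ‖z‖ < 1 := by
        refine lt_of_pow_lt_pow_left₀ 2 zero_le_one ?_
        nlinarith
      rw [hu z (hy'.trans_le hyz) hz1]
      exact (ENNReal.ofReal_le_ofReal (rpow_mul_log_le_radialLog hγ hy' hyz hzy hz1.le)).trans
        (Real.ofReal_le_enorm _)

lemma exists_le_sphericalAverage (hm : 0 < m) {β : ℝ} (hβ : 0 < β) :
    ∃ C : ℝ, 0 < C ∧ ∀ u : EuclideanSpace ℝ (Fin (m + 1)) → ℝ,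
      (∀ x, 0 < ‖x‖ → ‖x‖ < 1 → u x = radialLog (1 + β) x) →
      ∀ x, 0 < ‖x‖ → ‖x‖ ≤ 1 →
        ENNReal.ofReal (C * radialLog β x) ≤ sphericalAverage u x ‖x‖ := by
  set A := μH[(m : ℝ)] (Metric.sphere (0 : EuclideanSpace ℝ (Fin (m + 1))) 1)
  have hA : A < ⊤ := hausdorffMeasure_unit_sphere_lt_top
  set κ := (μH[(m : ℝ)] : Measure (EuclideanSpace ℝ (Fin m))).real (Metric.ball 0 1)
  have hκ : 0 < κ := ENNReal.toReal_pos (Metric.measure_ball_pos _ _ one_pos).ne'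
    Metric.isBounded_ball.measure_lt_top.ne
  have : Nontrivial (EuclideanSpace ℝ (Fin m)) :=
    Module.nontrivial_of_finrank_pos (R := ℝ) (by simpa)
  have hm' : (0 : ℝ) < m := by exact_mod_cast hm
  -- The factors come from |z| ≤ 2|y|, from the radial integral in dimension m, and from replacing
  -- log(2e/|x|) by 2 log(e/|x|). The + 1 in the next line makes the denominator positive without a
  -- lower bound on the area.
  set c := (2 : ℝ) ^ (-(m : ℝ)) * (m * κ * β⁻¹) * (2 : ℝ) ^ (-β)
  refine ⟨c / (A.toReal + 1), by positivity, fun u hu x hx hx1 ↦ ?_⟩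
  have hl := one_le_log_exp_one_div hx hx1
  have he1 : (1 : ℝ) < Real.exp 1 := by simp
  have hsphere : μH[(m : ℝ)] (Metric.sphere x ‖x‖) ≤
      ENNReal.ofReal (‖x‖ ^ m * (A.toReal + 1)) := by
    refine (hausdorffMeasure_sphere_le x hx).trans ?_
    rw [ENNReal.ofReal_mul (by positivity)]
    gcongr
    exact (ENNReal.ofReal_toReal hA.ne).ge.trans (ENNReal.ofReal_le_ofReal (by linarith))
  have hl2 : Real.log (Real.exp 1 / (‖x‖ / 2)) ≤ 2 * Real.log (Real.exp 1 / ‖x‖) := by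
    rw [show Real.exp 1 / (‖x‖ / 2) = 2 * (Real.exp 1 / ‖x‖) by field_simp,
      Real.log_mul two_ne_zero (by positivity)]
    linarith [Real.log_two_lt_d9]
  have hint : ENNReal.ofReal (c * Real.log (Real.exp 1 / ‖x‖) ^ (-β)) ≤
      ∫⁻ z in Metric.sphere x ‖x‖, ‖u z‖ₑ ∂μH[(m : ℝ)] := by
    refine le_trans ?_ (setLIntegral_ball_le_setLIntegral_sphere hm (by linarith) hu hx hx1)
    refine le_trans ?_ (lintegral_mono_set Metric.ball_subset_closedBall)
    have hi := integrableOn_ball_norm_rpow_mul_log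
      (μH[(m : ℝ)] : Measure (EuclideanSpace ℝ (Fin m))) (ρ := ‖x‖ / 2) hβ (by linarith)
    have hI := setIntegral_ball_norm_rpow_mul_log
      (μH[(m : ℝ)] : Measure (EuclideanSpace ℝ (Fin m))) (ρ := ‖x‖ / 2) hβ (by linarith)
      (by linarith)
    rw [finrank_euclideanSpace_fin] at hi hI
    rw [← ofReal_integral_eq_lintegral_ofReal (hi.const_mul _), integral_const_mul, hI]
    · refine ENNReal.ofReal_le_ofReal ?_
      have : (2 * Real.log (Real.exp 1 / ‖x‖)) ^ (-β) ≤
          Real.log (Real.exp 1 / (‖x‖ / 2)) ^ (-β) :=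
        Real.rpow_le_rpow_of_nonpos
          (log_exp_one_div_pos (by positivity) (by linarith)) hl2 (by linarith)
      rw [Real.mul_rpow zero_le_two (by linarith)] at this
      calc c * Real.log (Real.exp 1 / ‖x‖) ^ (-β)
          = (2 : ℝ) ^ (-(m : ℝ)) * (m * κ * β⁻¹) *
            ((2 : ℝ) ^ (-β) * Real.log (Real.exp 1 / ‖x‖) ^ (-β)) := by ring
        _ ≤ (2 : ℝ) ^ (-(m : ℝ)) * (m * κ * β⁻¹) *
            Real.log (Real.exp 1 / (‖x‖ / 2)) ^ (-β) := by gcongr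
        _ = _ := by ring
    · refine (ae_restrict_iff' measurableSet_ball).2 (Eventually.of_forall fun y hy ↦ ?_)
      rw [mem_ball_zero_iff] at hy
      rcases eq_or_ne y 0 with rfl | hy0
      · simp [hm.ne']
      · have := one_le_log_exp_one_div (norm_pos_iff.2 hy0) (by linarith)
        simp only [Pi.zero_apply]
        positivity
  rw [sphericalAverage, show ((m + 1 : ℕ) : ℝ) - 1 = m by push_cast; ring, setLAverage_eq]
  refine le_trans ?_ (ENNReal.div_le_div hint hsphere)
  rw [← ENNReal.ofReal_div_of_pos (by positivity)]
  refine ENNReal.ofReal_le_ofReal (le_of_eq ?_)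
  rw [radialLog, show (1 : ℝ) - ((m + 1 : ℕ) : ℝ) = -(m : ℝ) by push_cast; ring,
    Real.rpow_neg hx.le, Real.rpow_natCast]
  field_simp

end Sphere

/-! ### Removing an isolated singularity from the weak gradient. -/

section RemovablePoint

variable {E : Type*} [NormedAddCommGroup E] [InnerProductSpace ℝ E] [FiniteDimensional ℝ E]

/-- Take 1 - b((k+1)x) for a fixed bump b. The quantity ‖x‖‖∇η_k(x)‖ is scale invariant: it equals
‖y‖‖∇b(y)‖ at y = (k+1)x, which is bounded. -/
lemma exists_cutoff_away_from_zero :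
    ∃ η : ℕ → E → ℝ, (∀ k, ContDiff ℝ ∞ (η k)) ∧ (∀ k, η k =ᶠ[𝓝 0] 0) ∧
      (∀ k x, ‖η k x‖ ≤ 1) ∧ (∃ M, ∀ k x, ‖x‖ * ‖fderiv ℝ (η k) x‖ ≤ M) ∧
      (∀ x, x ≠ 0 → Tendsto (fun k ↦ η k x) atTop (𝓝 1)) ∧
      (∀ x, x ≠ 0 → Tendsto (fun k ↦ fderiv ℝ (η k) x) atTop (𝓝 0)) := by
  let b : ContDiffBump (0 : E) := ⟨1, 2, one_pos, one_lt_two⟩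
  have hb : ContDiff ℝ ∞ b := b.contDiff
  have hlarge : ∀ x : E, x ≠ 0 → ∀ᶠ k : ℕ in atTop, 2 < ‖((k : ℝ) + 1) • x‖ := by
    intro x hx
    have : Tendsto (fun k : ℕ ↦ ((k : ℝ) + 1) * ‖x‖) atTop atTop :=
      (tendsto_atTop_add_const_right _ 1 tendsto_natCast_atTop_atTop).atTop_mul_const
        (norm_pos_iff.2 hx)
    filter_upwards [this.eventually_gt_atTop 2] with k hk
    rwa [norm_smul, Real.norm_of_nonneg (by positivity)]
  have hfd : ∀ (k : ℕ) x, fderiv ℝ (fun x ↦ 1 - b (((k : ℝ) + 1) • x)) x =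
      -(((k : ℝ) + 1) • fderiv ℝ b (((k : ℝ) + 1) • x)) := by
    intro k x
    rw [fderiv_const_sub, fderiv_comp_smul]
  refine ⟨fun k x ↦ 1 - b (((k : ℝ) + 1) • x), fun k ↦ ?_, fun k ↦ ?_, fun k x ↦ ?_, ?_,
    fun x hx ↦ ?_, fun x hx ↦ ?_⟩
  · exact contDiff_const.sub (hb.comp (contDiff_id.const_smul _))
  · have : Tendsto (fun x : E ↦ ((k : ℝ) + 1) • x) (𝓝 0) (𝓝 0) := by
      simpa using (continuous_const_smul ((k : ℝ) + 1)).tendsto (0 : E)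
    filter_upwards [this b.eventuallyEq_one] with x hx
    have hx' : b (((k : ℝ) + 1) • x) = 1 := hx
    simp [hx']
  · rw [Real.norm_of_nonneg (sub_nonneg.2 b.le_one)]
    linarith [b.nonneg' (((k : ℝ) + 1) • x)]
  · have hcont : Continuous fun y : E ↦ ‖y‖ • fderiv ℝ b y :=
      continuous_norm.smul (hb.continuous_fderiv (by simp))
    obtain ⟨M, hM⟩ := ((b.hasCompactSupport.fderiv (𝕜 := ℝ)).smul_left
      (f := fun y : E ↦ ‖y‖)).exists_bound_of_continuous hcont
    refine ⟨M, fun k x ↦ ?_⟩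
    have := hM (((k : ℝ) + 1) • x)
    rw [Pi.smul_apply', norm_smul, norm_norm, norm_smul] at this
    rw [hfd, norm_neg, norm_smul]
    linarith
  · refine tendsto_const_nhds.congr' ?_
    filter_upwards [hlarge x hx] with k hk
    rw [b.zero_of_le_dist (by simpa using hk.le), sub_zero]
  · refine tendsto_const_nhds.congr' ?_
    filter_upwards [hlarge x hx] with k hk
    have : ((k : ℝ) + 1) • x ∉ tsupport (fderiv ℝ b) := fun h ↦ by
      have := tsupport_fderiv_subset ℝ h
      rw [b.tsupport_eq, mem_closedBall_zero_iff] at this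
      exact absurd this hk.not_ge
    rw [hfd, image_eq_zero_of_notMem_tsupport this, smul_zero, neg_zero]

end RemovablePoint

lemma gradient_apply {n : ℕ} (u : EuclideanSpace ℝ (Fin n) → ℝ) (x : EuclideanSpace ℝ (Fin n))
    (i : Fin n) : gradient u x i = fderiv ℝ u x (EuclideanSpace.single i 1) := by
  rw [← inner_gradient_left, EuclideanSpace.inner_single_right]
  simp

/-- An isolated singularity at which `|u| / |x|` is integrable does not contribute to the weak
gradient. -/
lemma isWeakGradient_gradient {n : ℕ} [Nontrivial (EuclideanSpace ℝ (Fin n))]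
    {u : EuclideanSpace ℝ (Fin n) → ℝ}
    (hd : ∀ x, x ≠ 0 → DifferentiableAt ℝ u x) (hu : Integrable u)
    (hux : Integrable fun x ↦ ‖x‖⁻¹ * u x) (hG : Integrable (gradient u)) :
    IsWeakGradient u (gradient u) := by
  intro φ hφ hφc i
  obtain ⟨η, hη, hη0, hη1, ⟨M, hM⟩, hlim, hlim'⟩ :=
    exists_cutoff_away_from_zero (E := EuclideanSpace ℝ (Fin n))
  set v : EuclideanSpace ℝ (Fin n) := EuclideanSpace.single i 1
  have hv : ‖v‖ = 1 := by simp [v]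
  have hui : Integrable fun x ↦ gradient u x i :=
    (EuclideanSpace.proj (𝕜 := ℝ) i).integrable_comp hG
  have hcφ := hφ.continuous
  have hcφ' : Continuous fun x ↦ fderiv ℝ φ x v :=
    (hφ.continuous_fderiv (by simp)).clm_apply continuous_const
  have hsφ' : HasCompactSupport fun x ↦ fderiv ℝ φ x v := hφc.fderiv_apply (𝕜 := ℝ) v
  have hcη : ∀ k, Continuous (η k) := fun k ↦ (hη k).continuous
  have hcη' : ∀ k, Continuous fun x ↦ fderiv ℝ (η k) x v := fun k ↦
    ((hη k).continuous_fderiv (by simp)).clm_apply continuous_const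
  have hfd : ∀ k x, fderiv ℝ (fun x ↦ η k x * u x) x v =
      η k x * gradient u x i + u x * fderiv ℝ (η k) x v := by
    intro k x
    rcases eq_or_ne x 0 with rfl | hx
    · have h1 : (fun x ↦ η k x * u x) =ᶠ[𝓝 0] 0 := by
        filter_upwards [hη0 k] with x hx
        simp [hx]
      rw [h1.fderiv_eq, (hη0 k).fderiv_eq, (hη0 k).eq_of_nhds]
      simp
    · rw [fderiv_fun_mul ((hη k).differentiable (by simp) x) (hd x hx), gradient_apply]
      simp [v]
  have hdiff : ∀ k, Differentiable ℝ fun x ↦ η k x * u x := by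
    intro k x
    rcases eq_or_ne x 0 with rfl | hx
    · have h1 : (fun x ↦ η k x * u x) =ᶠ[𝓝 0] fun _ ↦ (0 : ℝ) := by
        filter_upwards [hη0 k] with x hx
        simp [hx]
      exact (differentiableAt_const _).congr_of_eventuallyEq h1
    · exact ((hη k).differentiable (by simp) x).mul (hd x hx)
  have i1 : ∀ k, Integrable fun x ↦ (η k x * fderiv ℝ φ x v) • u x := fun k ↦
    hu.locallyIntegrable.integrable_smul_left_of_hasCompactSupport ((hcη k).mul hcφ')
      hsφ'.mul_left
  have i2 : ∀ k, Integrable fun x ↦ (η k x * φ x) • gradient u x i := fun k ↦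
    hui.locallyIntegrable.integrable_smul_left_of_hasCompactSupport ((hcη k).mul hcφ) hφc.mul_left
  have i3 : ∀ k, Integrable fun x ↦ (fderiv ℝ (η k) x v * φ x) • u x := fun k ↦
    hu.locallyIntegrable.integrable_smul_left_of_hasCompactSupport ((hcη' k).mul hcφ) hφc.mul_left
  have i4 : ∀ k, Integrable fun x ↦ (η k x * φ x) • u x := fun k ↦
    hu.locallyIntegrable.integrable_smul_left_of_hasCompactSupport ((hcη k).mul hcφ) hφc.mul_left
  -- Since η_k vanishes near 0, η_k u is differentiable everywhere and classical integration by
  -- parts applies.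
  have hparts : ∀ k, ∫ x, (η k x * fderiv ℝ φ x v) • u x =
      -((∫ x, (η k x * φ x) • gradient u x i) + ∫ x, (fderiv ℝ (η k) x v * φ x) • u x) := by
    intro k
    have e1 : ∀ x, (η k x * u x) * fderiv ℝ φ x v = (η k x * fderiv ℝ φ x v) • u x := fun x ↦ by
      rw [smul_eq_mul]; ring
    have e2 : ∀ x, fderiv ℝ (fun x ↦ η k x * u x) x v * φ x =
        (η k x * φ x) • gradient u x i + (fderiv ℝ (η k) x v * φ x) • u x := fun x ↦ by
      rw [hfd, smul_eq_mul, smul_eq_mul]; ring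
    have e3 : ∀ x, (η k x * u x) * φ x = (η k x * φ x) • u x := fun x ↦ by
      rw [smul_eq_mul]; ring
    have := integral_mul_fderiv_eq_neg_fderiv_mul_of_integrable (μ := volume)
      (f := fun x ↦ η k x * u x) (g := φ) (v := v) (by simp only [e2]; exact (i2 k).add (i3 k))
      (by simpa only [e1] using i1 k) (by simpa only [e3] using i4 k)
      (fun x _ ↦ hdiff k x) (fun x _ ↦ hφ.differentiable (by simp) x)
    simp only [e1, e2] at this
    rw [this, integral_add (i2 k) (i3 k)]
  have hne : ∀ᵐ x : EuclideanSpace ℝ (Fin n), x ≠ 0 := by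
    simp [ae_iff]
  have t1 : Tendsto (fun k ↦ ∫ x, (η k x * fderiv ℝ φ x v) • u x) atTop
      (𝓝 (∫ x, u x * fderiv ℝ φ x v)) := by
    refine tendsto_integral_of_dominated_convergence (fun x ↦ ‖fderiv ℝ φ x v • u x‖)
      (fun k ↦ (i1 k).aestronglyMeasurable)
      (hu.locallyIntegrable.integrable_smul_left_of_hasCompactSupport hcφ' hsφ').norm
      (fun k ↦ Eventually.of_forall fun x ↦ ?_) (hne.mono fun x hx ↦ ?_)
    · rw [mul_smul, norm_smul]
      exact mul_le_of_le_one_left (norm_nonneg _) (hη1 k x)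
    · simpa [mul_comm] using ((hlim x hx).mul_const (fderiv ℝ φ x v)).smul_const (u x)
  have t2 : Tendsto (fun k ↦ ∫ x, (η k x * φ x) • gradient u x i) atTop
      (𝓝 (∫ x, gradient u x i * φ x)) := by
    refine tendsto_integral_of_dominated_convergence (fun x ↦ ‖φ x • gradient u x i‖)
      (fun k ↦ (i2 k).aestronglyMeasurable)
      (hui.locallyIntegrable.integrable_smul_left_of_hasCompactSupport hcφ hφc).norm
      (fun k ↦ Eventually.of_forall fun x ↦ ?_) (hne.mono fun x hx ↦ ?_)
    · rw [mul_smul, norm_smul]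
      exact mul_le_of_le_one_left (norm_nonneg _) (hη1 k x)
    · simpa [mul_comm] using ((hlim x hx).mul_const (φ x)).smul_const (gradient u x i)
  -- The error term is dominated by M|φ||u|/|x|; this is where integrability of |u|/|x| enters.
  have t3 : Tendsto (fun k ↦ ∫ x, (fderiv ℝ (η k) x v * φ x) • u x) atTop (𝓝 0) := by
    rw [← integral_zero (EuclideanSpace ℝ (Fin n)) ℝ]
    refine tendsto_integral_of_dominated_convergence
      (fun x ↦ M * ‖φ x • (‖x‖⁻¹ * u x)‖) (fun k ↦ (i3 k).aestronglyMeasurable)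
      ((hux.locallyIntegrable.integrable_smul_left_of_hasCompactSupport hcφ hφc).norm.const_mul M)
      (fun k ↦ hne.mono fun x hx ↦ ?_) (hne.mono fun x hx ↦ ?_)
    · have hx' := norm_pos_iff.2 hx
      have h1 : ‖fderiv ℝ (η k) x v‖ ≤ M * ‖x‖⁻¹ := by
        rw [← div_eq_mul_inv, le_div_iff₀ hx', mul_comm]
        refine le_trans ?_ (hM k x)
        gcongr
        simpa [hv] using (fderiv ℝ (η k) x).le_opNorm v
      calc ‖(fderiv ℝ (η k) x v * φ x) • u x‖ = ‖fderiv ℝ (η k) x v‖ * (‖φ x‖ * ‖u x‖) := by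
            rw [norm_smul, norm_mul, mul_assoc]
        _ ≤ M * ‖x‖⁻¹ * (‖φ x‖ * ‖u x‖) := by gcongr
        _ = _ := by
            rw [norm_smul, norm_mul, norm_inv, norm_norm]; ring
    · have h1 : Tendsto (fun k ↦ fderiv ℝ (η k) x v) atTop (𝓝 0) := by
        simpa [Function.comp_def] using ((ContinuousLinearMap.apply ℝ ℝ v).continuous.tendsto _).comp (hlim' x hx)
      simpa using (h1.mul_const (φ x)).smul_const (u x)
  have := tendsto_nhds_unique t1 (((t2.add t3).neg).congr fun k ↦ (hparts k).symm)
  simpa using this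

/-! ### Admissible functions and the conclusion. -/

section Admissible

variable {n : ℕ}

/-- Inside the unit ball w is dominated by the radial model; the rest of its support is compact and
avoids the singularity. -/
lemma integrable_of_norm_le_rpow_mul_log [Nontrivial (EuclideanSpace ℝ (Fin n))]
    {F : Type*} [NormedAddCommGroup F] [SecondCountableTopology F]
    {w : EuclideanSpace ℝ (Fin n) → F} (hw : ContinuousOn w {0}ᶜ) (hc : HasCompactSupport w)
    {β M : ℝ} (hβ : 0 < β)
    (hM : ∀ x, 0 < ‖x‖ → ‖x‖ < 1 →
      ‖w x‖ ≤ M * (‖x‖ ^ (-(n : ℝ)) * Real.log (Real.exp 1 / ‖x‖) ^ (-(1 + β)))) :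
    Integrable w := by
  have hm : AEStronglyMeasurable w := by
    have := hw.aestronglyMeasurable (μ := volume) (measurableSet_singleton _).compl
    rwa [restrict_compl_singleton] at this
  have h1 : IntegrableOn w (Metric.ball 0 1) := by
    have he : (1 : ℝ) < Real.exp 1 := by simp
    have := (integrableOn_ball_norm_rpow_mul_log
      (volume : Measure (EuclideanSpace ℝ (Fin n))) (ρ := 1) hβ he).const_mul M
    rw [finrank_euclideanSpace_fin] at this
    refine Integrable.mono' this hm.restrict ?_
    have hne : ∀ᵐ x : EuclideanSpace ℝ (Fin n), x ≠ 0 := by simp [ae_iff]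
    refine (ae_restrict_iff' measurableSet_ball).2 (hne.mono fun x hx hx1 ↦ ?_)
    exact hM x (norm_pos_iff.2 hx) (mem_ball_zero_iff.1 hx1)
  have h2 : IntegrableOn w (tsupport w \ Metric.ball 0 1) := by
    refine ContinuousOn.integrableOn_compact (hc.diff Metric.isOpen_ball) (hw.mono ?_)
    rintro x hx rfl
    exact hx.2 (Metric.mem_ball_self one_pos)
  refine (integrableOn_iff_integrable_of_support_subset fun x hx ↦ ?_).1 (h1.union h2)
  by_cases hx1 : x ∈ Metric.ball 0 1
  · exact Or.inl hx1
  · exact Or.inr ⟨subset_tsupport w hx, hx1⟩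

/-- Differentiating the logarithmic factor produces one more negative power of a logarithm that is
at least 1, so that term is absorbed. -/
lemma norm_fderiv_radialLog_le (hn : 1 ≤ n) {α : ℝ} (hα : 0 ≤ α) {x : EuclideanSpace ℝ (Fin n)}
    (hx : 0 < ‖x‖) (hx1 : ‖x‖ < 1) :
    ‖fderiv ℝ (radialLog α) x‖ ≤ ((n : ℝ) - 1 + α) *
      (‖x‖ ^ (-(n : ℝ)) * Real.log (Real.exp 1 / ‖x‖) ^ (-α)) := by
  have he : (1 : ℝ) < Real.exp 1 := by simp
  have hn' : (1 : ℝ) ≤ n := by exact_mod_cast hn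
  have hl := one_le_log_exp_one_div hx hx1.le
  have h1 := (Real.hasDerivAt_rpow_const (p := 1 - (n : ℝ)) (Or.inl hx.ne')).mul
    (hasDerivAt_log_exp_one_div_rpow α hx (hx1.trans he))
  have h2 : HasFDerivAt (fun y : EuclideanSpace ℝ (Fin n) ↦ ‖y‖) (fderiv ℝ (‖·‖) x) x :=
    ((contDiffAt_norm ℝ (norm_pos_iff.1 hx)).differentiableAt one_ne_zero).hasFDerivAt
  have h3 : HasFDerivAt (radialLog α) _ x := h1.comp_hasFDerivAt x h2
  have h4 : ‖fderiv ℝ (fun y : EuclideanSpace ℝ (Fin n) ↦ ‖y‖) x‖ ≤ 1 := by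
    simpa using norm_fderiv_le_of_lipschitz ℝ (x₀ := x) (lipschitzWith_one_norm
      (E := EuclideanSpace ℝ (Fin n)))
  rw [h3.fderiv, norm_smul]
  refine (mul_le_of_le_one_right (norm_nonneg _) h4).trans ?_
  have e1 : ‖x‖ ^ (1 - (n : ℝ) - 1) = ‖x‖ ^ (-(n : ℝ)) := by congr 1; ring
  have e2 : ‖x‖ ^ (1 - (n : ℝ)) = ‖x‖ ^ (-(n : ℝ)) * ‖x‖ := by
    rw [← Real.rpow_add_one hx.ne']; congr 1; ring
  have h5 : Real.log (Real.exp 1 / ‖x‖) ^ (-(1 + α)) ≤ Real.log (Real.exp 1 / ‖x‖) ^ (-α) :=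
    Real.rpow_le_rpow_of_exponent_le hl (by linarith)
  rw [e1, e2]
  refine (norm_add_le _ _).trans ?_
  rw [norm_mul, norm_mul, norm_mul, norm_mul, norm_mul, norm_mul,
    Real.norm_of_nonneg (Real.rpow_nonneg hx.le _),
    Real.norm_of_nonneg (Real.rpow_nonneg (by linarith : 0 ≤ Real.log (Real.exp 1 / ‖x‖)) (-α)),
    Real.norm_of_nonneg (Real.rpow_nonneg (by linarith : 0 ≤ Real.log (Real.exp 1 / ‖x‖)) (-(1 + α))),
    norm_norm, Real.norm_of_nonneg hα, norm_inv, norm_norm,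
    Real.norm_of_nonpos (by linarith : 1 - (n : ℝ) ≤ 0)]
  calc -(1 - (n : ℝ)) * ‖x‖ ^ (-(n : ℝ)) * Real.log (Real.exp 1 / ‖x‖) ^ (-α) +
      ‖x‖ ^ (-(n : ℝ)) * ‖x‖ * (α * (‖x‖⁻¹ * Real.log (Real.exp 1 / ‖x‖) ^ (-(1 + α))))
      = ((n : ℝ) - 1) * (‖x‖ ^ (-(n : ℝ)) * Real.log (Real.exp 1 / ‖x‖) ^ (-α)) +
        α * (‖x‖ ^ (-(n : ℝ)) * Real.log (Real.exp 1 / ‖x‖) ^ (-(1 + α))) := by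
        field_simp; ring
    _ ≤ ((n : ℝ) - 1) * (‖x‖ ^ (-(n : ℝ)) * Real.log (Real.exp 1 / ‖x‖) ^ (-α)) +
        α * (‖x‖ ^ (-(n : ℝ)) * Real.log (Real.exp 1 / ‖x‖) ^ (-α)) := by gcongr
    _ = _ := by ring

lemma IsSmoothExtension.memW11 (hn : 2 ≤ n) {u : EuclideanSpace ℝ (Fin n) → ℝ}
    (hu : IsSmoothExtension u) : MemW11 u := by
  have hn2 : (2 : ℝ) ≤ n := by exact_mod_cast hn
  have : Nontrivial (EuclideanSpace ℝ (Fin n)) :=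
    Module.nontrivial_of_finrank_pos (R := ℝ) (by simp; omega)
  set β := ((n : ℝ) - 1) / n
  have hβ : 0 < β := div_pos (by linarith) (by linarith)
  have hopen : IsOpen ({0}ᶜ : Set (EuclideanSpace ℝ (Fin n))) := isOpen_compl_singleton
  -- This bound also controls u itself, since ‖x‖⁻¹ ≥ 1 in the unit ball.
  have hnorm : ∀ x, 0 < ‖x‖ → ‖x‖ < 1 → ‖‖x‖⁻¹ * u x‖ ≤
      1 * (‖x‖ ^ (-(n : ℝ)) * Real.log (Real.exp 1 / ‖x‖) ^ (-(1 + β))) := by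
    intro x hx hx1
    have hl := one_le_log_exp_one_div hx hx1.le
    have e : ‖x‖ ^ (1 - (n : ℝ)) = ‖x‖ * ‖x‖ ^ (-(n : ℝ)) := by
      rw [sub_eq_add_neg, Real.rpow_add hx, Real.rpow_one]
    rw [hu.eq_formula x hx hx1, radialLog, e, Real.norm_of_nonneg (by positivity)]
    rw [one_mul, mul_assoc, inv_mul_cancel_left₀ hx.ne']
  have hcont : ContinuousOn u {0}ᶜ := hu.smooth.continuousOn
  have hux : Integrable fun x ↦ ‖x‖⁻¹ * u x := by
    refine integrable_of_norm_le_rpow_mul_log ?_ hu.compact_support.mul_left hβ hnorm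
    exact (continuousOn_id.norm.inv₀ fun x hx ↦ norm_ne_zero_iff.2 hx).mul hcont
  have hui : Integrable u := by
    refine integrable_of_norm_le_rpow_mul_log hcont hu.compact_support hβ fun x hx hx1 ↦
      le_trans ?_ (hnorm x hx hx1)
    rw [norm_mul, norm_inv, norm_norm]
    exact le_mul_of_one_le_left (norm_nonneg _) ((one_le_inv₀ hx).2 hx1.le)
  have hG : Integrable (gradient u) := by
    refine integrable_of_norm_le_rpow_mul_log (M := (n : ℝ) - 1 + (1 + β)) ?_
      ((hu.compact_support.fderiv (𝕜 := ℝ)).comp_left (map_zero (InnerProductSpace.toDual ℝ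
        (EuclideanSpace ℝ (Fin n))).symm)) hβ fun x hx hx1 ↦ ?_
    · exact (InnerProductSpace.toDual ℝ _).symm.continuous.comp_continuousOn
        (hu.smooth.continuousOn_fderiv_of_isOpen hopen (by simp))
    · have hev : u =ᶠ[𝓝 x] radialLog (1 + β) := by
        filter_upwards [(isOpen_lt continuous_const continuous_norm).mem_nhds hx,
          (isOpen_lt continuous_norm continuous_const).mem_nhds hx1] with y hy hy1
        exact hu.eq_formula y hy hy1
      rw [gradient, LinearIsometryEquiv.norm_map, hev.fderiv_eq]
      exact norm_fderiv_radialLog_le (by omega) (by linarith) hx hx1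
  exact ⟨hui, gradient u, hG, isWeakGradient_gradient (fun x hx ↦
    (hu.smooth.contDiffAt (hopen.mem_nhds hx)).differentiableAt (by simp)) hui hux hG⟩

/-- Multiply the formula by a bump that vanishes outside the ball of radius 2. As 2 < e, the
logarithm is positive wherever the bump is nonzero away from the origin. -/
lemma exists_nonneg_isSmoothExtension :
    ∃ u : EuclideanSpace ℝ (Fin n) → ℝ, (∀ x, 0 ≤ u x) ∧ IsSmoothExtension u := by
  let b : ContDiffBump (0 : EuclideanSpace ℝ (Fin n)) := ⟨1, 2, one_pos, one_lt_two⟩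
  have he : (2 : ℝ) < Real.exp 1 := by linarith [Real.exp_one_gt_d9]
  refine ⟨fun x ↦ b x * radialLog (1 + ((n : ℝ) - 1) / n) x, fun x ↦ ?_, fun x hx hx1 ↦ ?_,
    fun x hx ↦ ?_, b.hasCompactSupport.mul_right⟩
  · rcases lt_or_ge ‖x‖ 2 with h | h
    · refine mul_nonneg b.nonneg (mul_nonneg (by positivity) (Real.rpow_nonneg ?_ _))
      rcases (norm_nonneg x).eq_or_lt with h0 | h0
      · simp [← h0]
      · exact (log_exp_one_div_pos h0 (h.trans he)).le
    · simp [b.zero_of_le_dist (show b.rOut ≤ dist x 0 by simpa using h)]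
  · rw [b.one_of_mem_closedBall (by simpa using hx1.le), one_mul]
  · refine ContDiffAt.contDiffWithinAt ?_
    have hx0 : x ≠ 0 := hx
    have hxn : 0 < ‖x‖ := norm_pos_iff.2 hx0
    rcases lt_or_ge ‖x‖ (Real.exp 1) with h | h
    · refine b.contDiffAt.mul (ContDiffAt.mul ?_ ?_)
      · exact (contDiffAt_norm ℝ hx0).rpow_const_of_ne hxn.ne'
      · refine ContDiffAt.rpow_const_of_ne (ContDiffAt.log ?_ ?_) (log_exp_one_div_pos hxn h).ne'
        · exact contDiffAt_const.div (contDiffAt_norm ℝ hx0) hxn.ne'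
        · positivity
    · have : (fun x ↦ b x * radialLog (1 + ((n : ℝ) - 1) / n) x) =ᶠ[𝓝 x] fun _ ↦ (0 : ℝ) := by
        filter_upwards [(isOpen_lt continuous_const continuous_norm).mem_nhds (he.trans_le h)]
          with y (hy : 2 < ‖y‖)
        rw [b.zero_of_le_dist (by simpa using hy.le), zero_mul]
      exact contDiffAt_const.congr_of_eventuallyEq this

lemma sphericalAverage_le_sphericalMaximal (u : EuclideanSpace ℝ (Fin n) → ℝ)
    (x : EuclideanSpace ℝ (Fin n)) {t : ℝ} (ht : 0 < t) :
    sphericalAverage u x t ≤ sphericalMaximal u x :=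
  le_iSup₂ (f := fun t (_ : 0 < t) ↦ sphericalAverage u x t) t ht

lemma measurable_radialLog (α : ℝ) :
    Measurable (radialLog α : EuclideanSpace ℝ (Fin n) → ℝ) := by
  unfold radialLog
  fun_prop

lemma exists_le_sphericalAverage_of_isSmoothExtension (hn : 2 ≤ n) :
    ∃ C : ℝ, 0 < C ∧ ∀ u : EuclideanSpace ℝ (Fin n) → ℝ, IsSmoothExtension u →
      ∀ x, 0 < ‖x‖ → ‖x‖ ≤ 1 →
        ENNReal.ofReal (C * radialLog (((n : ℝ) - 1) / n) x) ≤ sphericalAverage u x ‖x‖ := by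
  obtain ⟨m, rfl⟩ := Nat.exists_eq_succ_of_ne_zero (by omega : n ≠ 0)
  have hn2 : (2 : ℝ) ≤ ((m + 1 : ℕ) : ℝ) := by exact_mod_cast hn
  obtain ⟨C, hC, h⟩ := exists_le_sphericalAverage (m := m) (by omega)
    (β := (((m + 1 : ℕ) : ℝ) - 1) / ((m + 1 : ℕ) : ℝ)) (div_pos (by linarith) (by linarith))
  exact ⟨C, hC, fun u hu ↦ h u hu.eq_formula⟩

/-- A representative g would lie in L^{n/(n-1)} of the unit ball, and so would the radial minorant,
which is at most C⁻¹|g| almost everywhere there. -/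
lemma IsSmoothExtension.not_memW11Loc_sphericalMaximal (hn : 2 ≤ n)
    {u : EuclideanSpace ℝ (Fin n) → ℝ} (hu : IsSmoothExtension u) :
    ¬ MemW11Loc (sphericalMaximal u) := by
  rintro ⟨g, hfg, hg, G, hG, hgG⟩
  have hn2 : (2 : ℝ) ≤ n := by exact_mod_cast hn
  have : Nontrivial (EuclideanSpace ℝ (Fin n)) :=
    Module.nontrivial_of_finrank_pos (R := ℝ) (by simp; omega)
  obtain ⟨C, hC, h⟩ := exists_le_sphericalAverage_of_isSmoothExtension hn
  refine not_memLp_radialLog hn (Metric.ball_mem_nhds 0 one_pos) ?_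
  have hp : NNReal.HolderConjugate (finrank ℝ (EuclideanSpace ℝ (Fin n)))
      ((n : ℝ) / ((n : ℝ) - 1)).toNNReal := by
    rw [← NNReal.holderConjugate_coe_iff, finrank_euclideanSpace_fin,
      Real.coe_toNNReal _ (div_nonneg (by linarith) (by linarith))]
    exact Real.HolderConjugate.conjExponent (by simp; omega)
  refine (memLp_ball_of_isWeakGradient hg hG hgG hp).of_le_mul (c := C⁻¹)
    (measurable_radialLog _).aestronglyMeasurable ?_
  have hne : ∀ᵐ x : EuclideanSpace ℝ (Fin n), x ≠ 0 := by simp [ae_iff]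
  refine (ae_restrict_iff' measurableSet_ball).2 ?_
  filter_upwards [hfg, hne] with x hx hx0 hx1
  have hxn := norm_pos_iff.2 hx0
  have hxn1 : ‖x‖ < 1 := mem_ball_zero_iff.1 hx1
  have hl := one_le_log_exp_one_div hxn hxn1.le
  have hpos : 0 ≤ radialLog (((n : ℝ) - 1) / n) x :=
    mul_nonneg (by positivity) (Real.rpow_nonneg (by linarith) _)
  have h1 := (h u hu x hxn hxn1.le).trans (sphericalAverage_le_sphericalMaximal u x hxn)
  have h2 : ((C * radialLog (((n : ℝ) - 1) / n) x : ℝ) : EReal) ≤ g x := by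
    rw [← hx, ← max_eq_left (mul_nonneg hC.le hpos), ← EReal.coe_ennreal_ofReal]
    exact EReal.coe_ennreal_le_coe_ennreal_iff.2 h1
  rw [EReal.coe_le_coe_iff] at h2
  rw [inv_mul_eq_div, le_div_iff₀ hC, Real.norm_of_nonneg hpos, mul_comm]
  exact h2.trans (Real.le_norm_self _)

end Admissible

theorem mainTheorem4 (n : ℕ) (hn : 2 ≤ n) :
    (∃ u : EuclideanSpace ℝ (Fin n) → ℝ, (∀ x, 0 ≤ u x) ∧ IsSmoothExtension u ∧
      HasCompactSupport u ∧ MemW11 u ∧ ¬ MemW11Loc (sphericalMaximal u)) ∧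
    (∀ u : EuclideanSpace ℝ (Fin n) → ℝ, IsSmoothExtension u →
      MemW11 u ∧ ¬ MemW11Loc (sphericalMaximal u)) ∧
    (∃ C : ℝ, 0 < C ∧ ∀ u : EuclideanSpace ℝ (Fin n) → ℝ, IsSmoothExtension u →
      ∀ x, 0 < ‖x‖ → ‖x‖ ≤ 1 →
        ENNReal.ofReal (C * radialLog (((n : ℝ) - 1) / n) x) ≤ sphericalAverage u x ‖x‖ ∧
        sphericalAverage u x ‖x‖ ≤ sphericalMaximal u x) ∧
    (∀ U ∈ 𝓝 (0 : EuclideanSpace ℝ (Fin n)),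
      ¬ MemLp (radialLog (((n : ℝ) - 1) / n)) (ENNReal.ofReal ((n : ℝ) / ((n : ℝ) - 1)))
        (volume.restrict U)) := by
  refine ⟨?_, fun u hu ↦ ⟨hu.memW11 hn, hu.not_memW11Loc_sphericalMaximal hn⟩, ?_,
    fun U hU ↦ not_memLp_radialLog hn hU⟩
  · obtain ⟨u, hu0, hu⟩ := exists_nonneg_isSmoothExtension (n := n)
    exact ⟨u, hu0, hu, hu.compact_support, hu.memW11 hn, hu.not_memW11Loc_sphericalMaximal hn⟩
  · obtain ⟨C, hC, h⟩ := exists_le_sphericalAverage_of_isSmoothExtension hn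
    exact ⟨C, hC, fun u hu x hx hx1 ↦
      ⟨h u hu x hx hx1, sphericalAverage_le_sphericalMaximal u x hx⟩⟩
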